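/- Let $M$ be a finite alphabet (for instance $M=\{1,\dots,d\}$) with a metric $d_M$, let $p_i>0$ for $i\in M$ with $\sum_{i\in M}p_i=1$, and let $\nu=\sum_{i\in M}p_i\delta_i$ be the a-priori probability on $M$. Equip $M^{\mathbb N}$ with the metric $d(x,y)=\sum_{n\ge 1}2^{-n}d_M(x_n,y_n)$ and let $\sigma(x_1,x_2,\dots)=(x_2,x_3,\dots)$ be the shift. For $B:M^{\mathbb N}\to\mathbb R$ let $$\mathcal L_B\varphi(x)=\int_M e^{B(ax)}\varphi(ax)\,d\nu(a),\qquad ax=(a,x_1,x_2,\dots).$$ Let $\mu$ be a Gibbs measure: a $\sigma$-invariant Borel probability on $M^{\mathbb N}$ such that, for some $\alpha>0$ and some $\alpha$-Hölder function $B$ (with respect to $d$) that is normalized, $\mathcal L_B 1=1$, we have $\mathcal L_B^*\mu=\mu$, that is, $\int\mathcal L_B\psi\,d\mu=\int\psi\,d\mu$ for every continuous $\psi$. For any such $B$ let $$h^\nu(\mu)=-\int B\,d\mu ,$$ and let $H(\mu)$ be the Kolmogorov–Sinai entropy of $\sigma$ with respect to $\mu$, that is, the supremum of the entropies of $\sigma$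 relative to all finite measurable partitions. Write $[i_1\dots i_n]=\{x\in M^{\mathbb N}:x_1=i_1,\dots,x_n=i_n\}$. Then (a) $\displaystyle H(\mu)=h^\nu(\mu)-\sum_{i\in M}\log(p_i)\,\mu([i])$; (b) $\displaystyle h^\nu(\mu)=-\lim_{n\to\infty}\frac1n\sum_{i_1,\dots,i_n\in M}\mu([i_1\dots i_n])\,\log\!\left(\frac{\mu([i_1\dots i_n])}{p_{i_1}\cdots p_{i_n}}\right)$, with the convention $0\log 0=0$; in particular the limit exists. -/

import Mathlib

open MeasureTheory Filter Topology

noncomputable section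

/-! ### The one-dimensional lattice `M^ℕ` (coordinates are numbered from `0`) -/

section Lattice

variable {M : Type*}

/-- The shift `σ (x₀, x₁, x₂, …) = (x₁, x₂, …)`. -/
def shift (x : ℕ → M) : ℕ → M := fun n => x (n + 1)

/-- The preimage `a x = (a, x₀, x₁, …)` of `x` under the shift. -/
def prepend (a : M) (x : ℕ → M) : ℕ → M
  | 0 => a
  | n + 1 => x n

/-- The cylinder `[w₀ … wₙ₋₁]` of all sequences that start with the word `w`. -/
def cylinderSet {n : ℕ} (w : Fin n → M) : Set (ℕ → M) := {x | ∀ j : Fin n, x j = w j}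

/-- The distance `∑_{n ≥ 1} 2⁻ⁿ d_M(xₙ, yₙ)` on the lattice. -/
def latticeDist [MetricSpace M] (x y : ℕ → M) : ℝ :=
  ∑' n : ℕ, (1 / 2 : ℝ) ^ (n + 1) * dist (x n) (y n)

/-- The class `H_α` of `α`-Hölder functions on the lattice. -/
def IsHolderPotential [MetricSpace M] (α : ℝ) (A : (ℕ → M) → ℝ) : Prop :=
  ∃ C : ℝ, ∀ x y : ℕ → M, |A x - A y| ≤ C * latticeDist x y ^ α

/-! ### The Ruelle operator and Gibbs measures -/

/-- The Ruelle operator of the potential `A` with a-priori probability `ν`: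
`(L_A φ)(x) = ∫ e^{A(ax)} φ(ax) dν(a)`. -/
def ruelleOp [MeasurableSpace M] (ν : Measure M) (A φ : (ℕ → M) → ℝ) : (ℕ → M) → ℝ :=
  fun x => ∫ a, Real.exp (A (prepend a x)) * φ (prepend a x) ∂ν

/-- `μ' = L_A^* μ`, that is, `∫ ψ dμ' = ∫ L_A ψ dμ` for every continuous `ψ`. -/
def IsDualImage [TopologicalSpace M] [MeasurableSpace M] (ν : Measure M) (A : (ℕ → M) → ℝ)
    (μ μ' : Measure (ℕ → M)) : Prop :=
  ∀ ψ : C(ℕ → M, ℝ), ∫ x, ψ x ∂μ' = ∫ x, ruelleOp ν A ψ x ∂μ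

/-- `μ` is a Gibbs measure with associated normalized potential `B ∈ H_α`:
`μ` is a shift-invariant probability, `L_B 1 = 1` and `L_B^* μ = μ`. -/
structure IsGibbsFor [MetricSpace M] [MeasurableSpace M] (α : ℝ) (ν : Measure M)
    (B : (ℕ → M) → ℝ) (μ : Measure (ℕ → M)) : Prop where
  isProbabilityMeasure : IsProbabilityMeasure μ
  invariant : MeasurePreserving shift μ μ
  isHolder : IsHolderPotential α B
  normalized : ∀ x, ruelleOp ν B (fun _ => 1) x = 1
  fixed : IsDualImage ν B μ μ

/-- The entropy `h^ν(μ) = - ∫ B dμ` of a Gibbs measure `μ` relative to the a-priori probability,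
`B` being a normalized potential associated to `μ`. -/
def gibbsEntropy [MeasurableSpace M] (B : (ℕ → M) → ℝ) (μ : Measure (ℕ → M)) : ℝ :=
  - ∫ x, B x ∂μ

/-- The a-priori measure `∑ pᵢ δᵢ` on a finite alphabet. -/
def aprioriMeasure [Fintype M] [MeasurableSpace M] (p : M → ℝ) : Measure M :=
  ∑ i, ENNReal.ofReal (p i) • Measure.dirac i

end Lattice

/-! ### The Kolmogorov–Sinai entropy of a measure-preserving map

A finite measurable partition into `k` (possibly empty) pieces is a measurable map to `Fin k`. -/

section KolmogorovSinai

variable {Ω : Type*}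

/-- Shannon entropy `- ∑ₐ μ(ξ = a) log μ(ξ = a)` of a finite partition, with `0 log 0 = 0`. -/
def partitionEntropy [MeasurableSpace Ω] {ι : Type*} [Fintype ι] (μ : Measure Ω) (ξ : Ω → ι) : ℝ :=
  ∑ a, Real.negMulLog (μ.real (ξ ⁻¹' {a}))

/-- The join `ξ ∨ T⁻¹ ξ ∨ … ∨ T^{-(n-1)} ξ`, as a map to words of length `n`. -/
def iteratedJoin {ι : Type*} (T : Ω → Ω) (ξ : Ω → ι) (n : ℕ) : Ω → (Fin n → ι) :=
  fun x j => ξ (T^[j] x)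

/-- The entropy `lim (1/n) H_μ(ξ ∨ … ∨ T^{-(n-1)} ξ)` of `T` relative to a finite partition. For an
invariant probability `μ` this bounded sequence converges by subadditivity, and the limit is
written as a `limsup`. -/
def entropyOfPartition [MeasurableSpace Ω] {ι : Type*} [Fintype ι] (μ : Measure Ω) (T : Ω → Ω)
    (ξ : Ω → ι) : EReal :=
  limsup (fun n : ℕ => ((1 / (n : ℝ) * partitionEntropy μ (iteratedJoin T ξ n) : ℝ) : EReal)) atTop

/-- The Kolmogorov–Sinai entropy: the supremum over all finite measurable partitions. -/
def kolmogorovEntropy [MeasurableSpace Ω] (μ : Measure Ω) (T : Ω → Ω) : EReal :=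
  ⨆ (k : ℕ) (ξ : Ω → Fin k) (_ : Measurable ξ), entropyOfPartition μ T ξ

end KolmogorovSinai

end

/-! ### Entropy and cross entropy of finite partitions -/

section FinitePartitions

variable {Ω ι κ : Type*} [MeasurableSpace Ω]
  [Fintype ι] [MeasurableSpace ι] [MeasurableSingletonClass ι]
  [Fintype κ] [MeasurableSpace κ] [MeasurableSingletonClass κ]

/-! Applied to the indicator of a cylinder, the fixed-point equation gives `μ[aw] = p a * ∫_{[w]}
exp (B (ax)) dμ`. A Hölder `B` varies by at most `K * r ^ n` on cylinders of length `n`. As these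
errors are summable, peeling off one letter at a time shows that `log (μ[x₀…xₙ₋₁] / ∏ p)` differs
from the Birkhoff sum of `B` by a constant independent of `n` and `x`
(`IsGibbsFor.exists_abs_log_sub_birkhoffSum_le`). By invariance the Birkhoff sum integrates to `n *
∫ B`; dividing by `n` gives (b).

Splitting the logarithm of the quotient turns (b) into the growth rate of the entropy of initial
words; by invariance the weights contribute `∑ log (p i) * μ[i]` per letter. It remains to see that
the coordinate partition attains the supremum defining the Kolmogorov–Sinai entropy. A finite
partition `ξ` agrees, off a set of measure `δ`, with a function of `m` coordinates. Predicting the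
`ξ`-name of length `n` from the initial word of length `n + m` then costs, in cross entropy, at most
`n` times a quantity that vanishes with `δ` (`partitionEntropy_iteratedJoin_le`). -/

theorem integrable_comp_of_fintype {μ : Measure Ω} [IsFiniteMeasure μ] {ξ : Ω → ι}
    (hξ : Measurable ξ) (f : ι → ℝ) : Integrable (fun x => f (ξ x)) μ :=
  (Integrable.of_finite (μ := μ.map ξ) (f := f)).comp_measurable hξ

theorem integral_comp_of_fintype {μ : Measure Ω} [IsFiniteMeasure μ] {ξ : Ω → ι}
    (hξ : Measurable ξ) (f : ι → ℝ) :
    ∫ x, f (ξ x) ∂μ = ∑ i, μ.real (ξ ⁻¹' {i}) * f i := by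
  rw [← integral_map (f := f) hξ.aemeasurable
      (Integrable.of_finite (μ := μ.map ξ)).aestronglyMeasurable,
    integral_fintype Integrable.of_finite]
  simp [map_measureReal_apply hξ]

theorem sum_measureReal_preimage_prodMk {μ : Measure Ω} [IsFiniteMeasure μ] {ξ : Ω → ι} {η : Ω → κ}
    (hξ : Measurable ξ) (hη : Measurable η) (a : ι) :
    ∑ b, μ.real ((fun x => (ξ x, η x)) ⁻¹' {(a, b)}) = μ.real (ξ ⁻¹' {a}) := by
  classical
  have h₁ := integral_comp_of_fintype (μ := μ) hξ (fun i => if i = a then 1 else 0)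
  have h₂ := integral_comp_of_fintype (μ := μ) (hξ.prodMk hη) (fun i => if i.1 = a then 1 else 0)
  simp only at h₂
  rw [h₁, Fintype.sum_prod_type] at h₂
  simpa [Finset.sum_ite_eq, ← Finset.sum_mul] using h₂.symm

theorem sum_measureReal_preimage_prodMk' {μ : Measure Ω} [IsFiniteMeasure μ] {ξ : Ω → ι}
    {η : Ω → κ} (hξ : Measurable ξ) (hη : Measurable η) (b : κ) :
    ∑ a, μ.real ((fun x => (ξ x, η x)) ⁻¹' {(a, b)}) = μ.real (η ⁻¹' {b}) := by
  rw [← sum_measureReal_preimage_prodMk hη hξ b]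
  refine Finset.sum_congr rfl fun a _ => ?_
  congr 1
  ext x
  simp [and_comm]

/-- An atom of the join has at most the mass of the atom of `ξ` containing it, so `-log` of its mass
is at least as large. -/
theorem partitionEntropy_le_prodMk {μ : Measure Ω} [IsFiniteMeasure μ] {ξ : Ω → ι} {η : Ω → κ}
    (hξ : Measurable ξ) (hη : Measurable η) :
    partitionEntropy μ ξ ≤ partitionEntropy μ (fun x => (ξ x, η x)) := by
  unfold partitionEntropy
  rw [Fintype.sum_prod_type]
  refine Finset.sum_le_sum fun a _ => ?_
  rw [← sum_measureReal_preimage_prodMk hξ hη a, Real.negMulLog, neg_mul, Finset.sum_mul,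
    ← Finset.sum_neg_distrib]
  refine Finset.sum_le_sum fun b _ => ?_
  rw [Real.negMulLog, neg_mul, neg_le_neg_iff]
  rcases (measureReal_nonneg (μ := μ) (s := (fun x => (ξ x, η x)) ⁻¹' {(a, b)})).eq_or_lt
    with h | h
  · simp [← h]
  · refine mul_le_mul_of_nonneg_left (Real.log_le_log h ?_) h.le
    exact Finset.single_le_sum
      (f := fun b => μ.real ((fun x => (ξ x, η x)) ⁻¹' {(a, b)}))
      (fun _ _ => measureReal_nonneg) (Finset.mem_univ b)

/-- This is `log t ≤ t - 1` at `t = r * q / s`. Summed over the atoms inside one atom of mass `r`,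
the remainder `r * q - s` becomes `r * (∑ q - 1)`, which is nonpositive for a subprobability `q`. -/
theorem negMulLog_le_cross {s r q : ℝ} (hs : 0 ≤ s) (hsr : s ≤ r) (hq : 0 < q) :
    Real.negMulLog s ≤ s * -Real.log r + s * -Real.log q + (r * q - s) := by
  rcases hs.eq_or_lt with rfl | h
  · simpa using mul_nonneg hsr hq.le
  · have hr : 0 < r := h.trans_le hsr
    have := Real.log_le_sub_one_of_pos (div_pos (mul_pos hr hq) h)
    rw [Real.log_div (mul_pos hr hq).ne' h.ne', Real.log_mul hr.ne' hq.ne'] at this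
    have h2 := mul_le_mul_of_nonneg_left this h.le
    have h3 : s * (r * q / s - 1) = r * q - s := by field_simp
    rw [h3] at h2
    simp only [Real.negMulLog]
    linarith

/-- The conditional entropy of `ξ` given `η` is at most its cross entropy relative to any
conditional distribution `q`. -/
theorem partitionEntropy_le_add_cross {μ : Measure Ω} [IsFiniteMeasure μ] {ξ : Ω → ι} {η : Ω → κ}
    (hξ : Measurable ξ) (hη : Measurable η) {q : ι → κ → ℝ} (hq : ∀ a b, 0 < q a b)
    (hq1 : ∀ b, ∑ a, q a b ≤ 1) :
    partitionEntropy μ ξ ≤ partitionEntropy μ η + ∫ x, -Real.log (q (ξ x) (η x)) ∂μ := by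
  refine (partitionEntropy_le_prodMk hξ hη).trans ?_
  have hint := integral_comp_of_fintype (μ := μ) (hξ.prodMk hη) (fun i => -Real.log (q i.1 i.2))
  simp only at hint
  rw [hint]
  unfold partitionEntropy
  simp only [Fintype.sum_prod_type_right]
  rw [← Finset.sum_add_distrib]
  refine Finset.sum_le_sum fun b _ => ?_
  have hb := sum_measureReal_preimage_prodMk' (μ := μ) hξ hη b
  calc ∑ a, Real.negMulLog (μ.real ((fun x => (ξ x, η x)) ⁻¹' {(a, b)}))
      ≤ ∑ a, (μ.real ((fun x => (ξ x, η x)) ⁻¹' {(a, b)}) * -Real.log (μ.real (η ⁻¹' {b}))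
        + μ.real ((fun x => (ξ x, η x)) ⁻¹' {(a, b)}) * -Real.log (q a b)
        + (μ.real (η ⁻¹' {b}) * q a b - μ.real ((fun x => (ξ x, η x)) ⁻¹' {(a, b)}))) := by
        refine Finset.sum_le_sum fun a _ => negMulLog_le_cross measureReal_nonneg ?_ (hq a b)
        refine measureReal_mono ?_
        intro x hx
        simp only [Set.mem_preimage, Set.mem_singleton_iff, Prod.mk.injEq] at hx ⊢
        exact hx.2
    _ = Real.negMulLog (μ.real (η ⁻¹' {b}))
        + ∑ a, μ.real ((fun x => (ξ x, η x)) ⁻¹' {(a, b)}) * -Real.log (q a b)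
        + μ.real (η ⁻¹' {b}) * (∑ a, q a b - 1) := by
        simp only [Finset.sum_add_distrib, Finset.sum_sub_distrib, ← Finset.sum_mul,
          ← Finset.mul_sum, hb, Real.negMulLog]
        ring
    _ ≤ _ := by
        have := mul_nonneg (measureReal_nonneg (μ := μ) (s := η ⁻¹' {b}))
          (sub_nonneg.2 (hq1 b))
        linarith

theorem partitionEntropy_equiv_comp {Ω ι κ : Type*} [MeasurableSpace Ω] [Fintype ι] [Fintype κ]
    (μ : Measure Ω) (ξ : Ω → ι) (e : ι ≃ κ) :
    partitionEntropy μ (fun x => e (ξ x)) = partitionEntropy μ ξ := by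
  unfold partitionEntropy
  rw [← e.sum_comp]
  refine Finset.sum_congr rfl fun a _ => ?_
  congr 2
  ext x
  simp

end FinitePartitions

/-! ### Initial words and the generating property of the coordinate partition -/

section Words

variable {M : Type*}

/-- The initial word of length `n` of a sequence. -/
def initialWord (n : ℕ) (x : ℕ → M) : Fin n → M := fun j => x j

theorem shift_iterate_apply (j : ℕ) (x : ℕ → M) (i : ℕ) : shift^[j] x i = x (j + i) := by
  induction j generalizing x with
  | zero => simp
  | succ j ih =>
    rw [Function.iterate_succ_apply, ih]
    simp only [shift]
    congr 1
    omega

theorem cylinderSet_eq_preimage {n : ℕ} (w : Fin n → M) :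
    cylinderSet w = initialWord n ⁻¹' {w} := by
  ext x
  simp [cylinderSet, initialWord, funext_iff]

theorem measurable_initialWord [MeasurableSpace M] (n : ℕ) :
    Measurable (initialWord n : (ℕ → M) → Fin n → M) :=
  measurable_pi_lambda _ fun j => measurable_pi_apply (j : ℕ)

open scoped symmDiff in
/-- Every finite measurable partition is close to one that depends on finitely many coordinates. -/
theorem exists_initialWord_approx [MeasurableSpace M] {μ : Measure (ℕ → M)} [IsFiniteMeasure μ]
    {k : ℕ} [NeZero k] {ξ : (ℕ → M) → Fin k} (hξ : Measurable ξ) {δ : ℝ} (hδ : 0 < δ) :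
    ∃ (m : ℕ) (g : (Fin m → M) → Fin k), μ.real {x | ξ x ≠ g (initialWord m x)} ≤ δ := by
  classical
  have hk : (0 : ℝ) < k := by exact_mod_cast Nat.pos_of_ne_zero (NeZero.ne k)
  have happ : ∀ a : Fin k, ∃ t ∈ measurableCylinders (fun _ : ℕ => M),
      μ (t ∆ (ξ ⁻¹' {a})) < ENNReal.ofReal (δ / k) := fun a =>
    exists_measure_symmDiff_lt_of_generateFrom_isSetRing isSetRing_measurableCylinders
      ⟨{Set.univ}, Set.countable_singleton _, by
        simpa using univ_mem_measurableCylinders (fun _ : ℕ => M), by simp⟩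
      generateFrom_measurableCylinders.symm (hξ (measurableSet_singleton a))
      (by simpa using div_pos hδ hk)
  choose t ht hμt using happ
  have hcyl : ∀ a, ∃ (s : Finset ℕ) (S : Set (s → M)), t a = cylinder s S := fun a => by
    obtain ⟨s, S, -, h⟩ := (mem_measurableCylinders (t a)).1 (ht a)
    exact ⟨s, S, h⟩
  choose s S hsS using hcyl
  obtain ⟨m, hm⟩ : ∃ m : ℕ, ∀ a, ∀ i ∈ s a, i < m := by
    refine ⟨(Finset.univ.biUnion s).sup id + 1, fun a i hi => Nat.lt_succ_of_le ?_⟩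
    exact Finset.le_sup (f := id) (Finset.mem_biUnion.2 ⟨a, Finset.mem_univ a, hi⟩)
  have hdep : ∀ a x y, initialWord m x = initialWord m y → x ∈ t a → y ∈ t a := by
    intro a x y hxy hx
    rw [hsS a, mem_cylinder] at hx ⊢
    convert hx using 1
    ext i
    exact (congrFun hxy ⟨i, hm a i i.2⟩).symm
  -- The cylinders `t a` need neither be disjoint nor cover the space. The arbitrary choice and the
  -- default `0` matter only on the symmetric differences: off them, `x ∈ t a` exactly when `ξ x =
  -- a`.
  let g : (Fin m → M) → Fin k := fun v =>
    if h : ∃ a, ∃ x, initialWord m x = v ∧ x ∈ t a then h.choose else 0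
  refine ⟨m, g, ?_⟩
  have hsub : {x | ξ x ≠ g (initialWord m x)} ⊆ ⋃ a, t a ∆ (ξ ⁻¹' {a}) := by
    intro x hx
    by_contra hcon
    simp only [Set.mem_iUnion, Set.mem_symmDiff, Set.mem_preimage, Set.mem_singleton_iff,
      not_exists, not_or, not_and, not_not] at hcon
    have hex : ∃ a, ∃ y, initialWord m y = initialWord m x ∧ y ∈ t a :=
      ⟨ξ x, x, rfl, (hcon (ξ x)).2 rfl⟩
    obtain ⟨y, hy, hyt⟩ := hex.choose_spec
    refine hx ?_
    simp only [g, dif_pos hex]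
    exact (hcon _).1 (hdep _ _ _ hy hyt)
  calc μ.real {x | ξ x ≠ g (initialWord m x)} ≤ μ.real (⋃ a, t a ∆ (ξ ⁻¹' {a})) :=
        measureReal_mono hsub
    _ ≤ ∑ a, μ.real (t a ∆ (ξ ⁻¹' {a})) := measureReal_iUnion_fintype_le _
    _ ≤ ∑ _a : Fin k, δ / k := Finset.sum_le_sum fun a _ =>
        ENNReal.toReal_le_of_le_ofReal (div_pos hδ hk).le (hμt a).le
    _ = δ := by simp; field_simp

variable [Fintype M] [MeasurableSpace M] [MeasurableSingletonClass M]

theorem integral_sum_comp_iterate {Ω : Type*} [MeasurableSpace Ω] {μ : Measure Ω} {T : Ω → Ω}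
    (hT : MeasurePreserving T μ μ) {f : Ω → ℝ} (hf : Integrable f μ) (n : ℕ) :
    ∫ x, ∑ j ∈ Finset.range n, f (T^[j] x) ∂μ = n * ∫ x, f x ∂μ := by
  have hj : ∀ j, Integrable (fun x => f (T^[j] x)) μ ∧ ∫ x, f (T^[j] x) ∂μ = ∫ x, f x ∂μ := by
    intro j
    have h := hT.iterate j
    have hf' : Integrable f (μ.map T^[j]) := by rwa [h.map_eq]
    refine ⟨hf'.comp_measurable h.measurable, ?_⟩
    rw [← integral_map h.measurable.aemeasurable hf'.aestronglyMeasurable, h.map_eq]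
  rw [integral_finsetSum _ fun j _ => (hj j).1]
  simp [fun j => (hj j).2]

/-- The cross-entropy bound is applied to a product kernel that guesses each letter of the `ξ`-name
from its own window of `m` coordinates. By invariance each of the `n` letters has the same expected
cost. -/
theorem partitionEntropy_iteratedJoin_le {μ : Measure (ℕ → M)} [IsProbabilityMeasure μ]
    (hμ : MeasurePreserving shift μ μ) {k : ℕ} [NeZero k] {ξ : (ℕ → M) → Fin k}
    (hξ : Measurable ξ) {m : ℕ} (g : (Fin m → M) → Fin k) {δ : ℝ} (hδ : 0 < δ) (hδ1 : δ < 1)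
    (hg : μ.real {x | ξ x ≠ g (initialWord m x)} ≤ δ) (n : ℕ) :
    partitionEntropy μ (iteratedJoin shift ξ n) ≤
      partitionEntropy μ (initialWord (M := M) (n + m)) +
        n * (-Real.log (1 - δ) + δ * Real.log (k / δ)) := by
  classical
  have hk : (1 : ℝ) ≤ k := by exact_mod_cast Nat.pos_of_ne_zero (NeZero.ne k)
  have hkδ : 0 < δ / k := div_pos hδ (by linarith)
  -- Mixture of the exact guess, with weight `1 - δ`, and the uniform law, with weight `δ`. A right
  -- guess costs at most `-log (1 - δ)`; the uniform part caps the cost of a wrong one at `log (k /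
  -- δ)`.
  let q₁ : Fin k → Fin k → ℝ := fun a b => (1 - δ) * (if a = b then 1 else 0) + δ / k
  have hq₁ : ∀ a b, δ / k ≤ q₁ a b := fun a b => by
    have : 0 ≤ (1 - δ) * (if a = b then (1 : ℝ) else 0) :=
      mul_nonneg (by linarith) (by split_ifs <;> simp)
    simp only [q₁]
    linarith
  have hq₁pos : ∀ a b, 0 < q₁ a b := fun a b => hkδ.trans_le (hq₁ a b)
  have hq₁diag : ∀ a, 1 - δ ≤ q₁ a a := fun a => by simp [q₁, hkδ.le]
  have hq₁sum : ∀ b, ∑ a, q₁ a b = 1 := fun b => by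
    simp only [q₁, Finset.sum_add_distrib, ← Finset.mul_sum]
    simp
    field_simp
    ring
  let L : (ℕ → M) → ℝ := fun x => -Real.log (q₁ (ξ x) (g (initialWord m x)))
  have hpair : Measurable fun x => (ξ x, initialWord m x) := hξ.prodMk (measurable_initialWord m)
  have hLint : Integrable L μ :=
    integrable_comp_of_fintype (μ := μ) hpair (fun i => -Real.log (q₁ i.1 (g i.2)))
  have hbad : MeasurableSet {x | ξ x ≠ g (initialWord m x)} :=
    (measurableSet_eq_fun hξ ((measurable_of_finite g).comp (measurable_initialWord m))).compl
  have hlog : 0 ≤ Real.log (k / δ) := Real.log_nonneg (by rw [le_div_iff₀ hδ]; linarith)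
  have hlog1 : 0 ≤ -Real.log (1 - δ) := by
    have := Real.log_nonpos (x := 1 - δ) (by linarith) (by linarith)
    linarith
  have hLle : ∫ x, L x ∂μ ≤ -Real.log (1 - δ) + δ * Real.log (k / δ) := by
    have hind : Integrable ({x | ξ x ≠ g (initialWord m x)}.indicator
        fun _ => Real.log (k / δ)) μ := (integrable_const _).indicator hbad
    calc ∫ x, L x ∂μ ≤ ∫ x, (-Real.log (1 - δ) + {x | ξ x ≠ g (initialWord m x)}.indicator
          (fun _ => Real.log (k / δ)) x) ∂μ := by
          refine integral_mono hLint ((integrable_const _).add hind) fun x => ?_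
          by_cases hx : ξ x = g (initialWord m x)
          · have h := Real.log_le_log (by linarith) (hq₁diag (ξ x))
            simp only [L, ← hx, Set.indicator, Set.mem_ofPred_eq, ne_eq, not_true_eq_false,
              if_false, add_zero]
            linarith
          · have h := Real.log_le_log hkδ (hq₁ (ξ x) (g (initialWord m x)))
            have h' : Real.log (k / δ) = -Real.log (δ / k) := by
              rw [← Real.log_inv, inv_div]
            simp only [L, Set.indicator, Set.mem_ofPred_eq, ne_eq, hx, not_false_eq_true, if_true]
            linarith
      _ = -Real.log (1 - δ) + μ.real {x | ξ x ≠ g (initialWord m x)} * Real.log (k / δ) := by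
          rw [integral_add (integrable_const _) hind, integral_indicator_const _ hbad]
          simp
      _ ≤ _ := by gcongr
  -- The window starting at `j < n` ends before `n + m`, hence words of that length.
  let q : (Fin n → Fin k) → (Fin (n + m) → M) → ℝ := fun a v =>
    ∏ j, q₁ (a j) (g fun i => v ⟨j + i, by omega⟩)
  have hjoin : Measurable (iteratedJoin shift ξ n) :=
    measurable_pi_lambda _ fun j => hξ.comp (hμ.iterate j).measurable
  have hmain := partitionEntropy_le_add_cross (μ := μ) hjoin (measurable_initialWord (n + m))
    (q := q) (fun a b => Finset.prod_pos fun j _ => hq₁pos _ _) (fun b => by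
      have := Finset.prod_univ_sum (fun _ : Fin n => (Finset.univ : Finset (Fin k)))
        (fun j a => q₁ a (g fun i => b ⟨j + i, by omega⟩))
      simp only [hq₁sum, Finset.prod_const_one, Fintype.piFinset_univ] at this
      exact this.symm.le)
  refine hmain.trans (add_le_add le_rfl ?_)
  have hpt : ∀ x, -Real.log (q (iteratedJoin shift ξ n x) (initialWord (n + m) x)) =
      ∑ j ∈ Finset.range n, L (shift^[j] x) := fun x => by
    simp only [q, L]
    rw [Real.log_prod fun j _ => (hq₁pos _ _).ne', ← Finset.sum_neg_distrib,
      Finset.sum_range (n := n)]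
    refine Finset.sum_congr rfl fun j _ => ?_
    congr 4
    ext i
    simp [initialWord, shift_iterate_apply]
  simp only [hpt]
  rw [integral_sum_comp_iterate hμ hLint]
  exact mul_le_mul_of_nonneg_left hLle (Nat.cast_nonneg n)

/-- The coordinate partition of the full shift is generating: no finite partition has larger
entropy than the growth rate of the entropies of initial words. -/
theorem entropyOfPartition_le_of_tendsto {μ : Measure (ℕ → M)} [IsProbabilityMeasure μ]
    (hμ : MeasurePreserving shift μ μ) {h : ℝ}
    (hh : Tendsto (fun n : ℕ => 1 / (n : ℝ) * partitionEntropy μ (initialWord (M := M) n))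
      atTop (𝓝 h))
    {k : ℕ} {ξ : (ℕ → M) → Fin k} (hξ : Measurable ξ) :
    entropyOfPartition μ shift ξ ≤ (h : EReal) := by
  have hne : Nonempty (ℕ → M) := nonempty_of_isProbabilityMeasure μ
  have hk0 : NeZero k := ⟨by rintro rfl; exact (ξ hne.some).elim0⟩
  rw [← EReal.le_of_forall_lt_iff_le]
  intro z hz
  rw [EReal.coe_lt_coe_iff] at hz
  have hκ : Tendsto (fun δ : ℝ => -Real.log (1 - δ) + δ * Real.log (k / δ)) (𝓝[>] 0) (𝓝 0) := by
    have h1 : Tendsto (fun δ : ℝ => -Real.log (1 - δ) + (δ * Real.log k + Real.negMulLog δ))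
        (𝓝 0) (𝓝 0) := by
      have hc : ContinuousAt
          (fun δ : ℝ => -Real.log (1 - δ) + (δ * Real.log k + Real.negMulLog δ)) 0 := by
        refine ContinuousAt.add (ContinuousAt.neg ?_) (ContinuousAt.add (by fun_prop)
          Real.continuous_negMulLog.continuousAt)
        exact ContinuousAt.log (by fun_prop) (by norm_num)
      simpa [ContinuousAt] using hc
    refine (h1.mono_left nhdsWithin_le_nhds).congr' ?_
    filter_upwards [self_mem_nhdsWithin] with δ hδ
    rw [Real.log_div (by exact_mod_cast NeZero.ne k) (ne_of_gt hδ), Real.negMulLog]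
    ring
  -- Half of the gap `z - h` pays for the approximation, the other half for the convergence of the
  -- word entropies along `n + m`.
  obtain ⟨δ, hκδ, hδ, hδ1⟩ := ((hκ.eventually_lt_const
    (show (0 : ℝ) < (z - h) / 2 by linarith)).and (Ioo_mem_nhdsGT one_pos)).exists
  obtain ⟨m, g, hg⟩ := exists_initialWord_approx (μ := μ) hξ hδ
  have hbound := partitionEntropy_iteratedJoin_le hμ hξ g hδ hδ1 hg
  set c := fun n => partitionEntropy μ (initialWord (M := M) n) with hc
  have hlim : Tendsto (fun n : ℕ => ((n + m : ℕ) : ℝ) / n * (1 / ((n + m : ℕ) : ℝ) * c (n + m)))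
      atTop (𝓝 (1 * h)) := by
    refine Tendsto.mul ?_ (hh.comp (tendsto_add_atTop_nat m))
    have : Tendsto (fun n : ℕ => 1 + (m : ℝ) / n) atTop (𝓝 (1 + 0)) :=
      tendsto_const_nhds.add (tendsto_const_div_atTop_nhds_zero_nat (m : ℝ))
    rw [add_zero] at this
    refine this.congr' ?_
    filter_upwards [eventually_gt_atTop 0] with n hn
    have : (n : ℝ) ≠ 0 := by exact_mod_cast hn.ne'
    push_cast
    field_simp
  rw [one_mul] at hlim
  refine limsup_le_of_le (by isBoundedDefault) ?_
  filter_upwards [hlim.eventually_lt_const (show h < h + (z - h) / 2 by linarith),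
    eventually_gt_atTop 0] with n hn hn0
  rw [EReal.coe_le_coe_iff]
  have hn' : (0 : ℝ) < n := by exact_mod_cast hn0
  have hnm : ((n + m : ℕ) : ℝ) ≠ 0 := by positivity
  have he : ((n + m : ℕ) : ℝ) / n * (1 / ((n + m : ℕ) : ℝ) * c (n + m)) = 1 / n * c (n + m) := by
    field_simp
  rw [he] at hn
  have h1 := mul_le_mul_of_nonneg_left (hbound n) (show 0 ≤ 1 / (n : ℝ) by positivity)
  rw [mul_add, ← mul_assoc (1 / (n : ℝ)) (n : ℝ), one_div_mul_cancel hn'.ne', one_mul] at h1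
  simp only [hc] at hn
  linarith

/-- The value is attained by the partition according to the zeroth coordinate, whose iterated joins
are the initial words up to relabelling. -/
theorem kolmogorovEntropy_shift_of_tendsto {μ : Measure (ℕ → M)} [IsProbabilityMeasure μ]
    (hμ : MeasurePreserving shift μ μ) {h : ℝ}
    (hh : Tendsto (fun n : ℕ => 1 / (n : ℝ) * partitionEntropy μ (initialWord (M := M) n))
      atTop (𝓝 h)) :
    kolmogorovEntropy μ shift = (h : EReal) := by
  refine le_antisymm (iSup_le fun k => iSup_le fun ξ => iSup_le fun hξ =>
    entropyOfPartition_le_of_tendsto hμ hh hξ) ?_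
  let e := Fintype.equivFin M
  have hξ : Measurable fun x : ℕ → M => e (x 0) :=
    (measurable_of_finite e).comp (measurable_pi_apply 0)
  refine le_trans (le_of_eq ?_) (le_iSup_of_le (Fintype.card M)
    (le_iSup_of_le (fun x : ℕ → M => e (x 0)) (le_iSup_of_le hξ le_rfl)))
  have hent : ∀ n, partitionEntropy μ (iteratedJoin shift (fun x : ℕ → M => e (x 0)) n) =
      partitionEntropy μ (initialWord (M := M) n) := fun n => by
    rw [← partitionEntropy_equiv_comp μ (initialWord n) (Equiv.piCongrRight fun _ => e)]
    congr 1
    ext x j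
    simp [iteratedJoin, initialWord, shift_iterate_apply]
  unfold entropyOfPartition
  simp only [hent]
  exact ((continuous_coe_real_ereal.tendsto h).comp hh).limsup_eq.symm

end Words

/-! ### Variation of Hölder potentials on cylinders -/

section HolderPotentials

variable {M : Type*} [Fintype M] [MetricSpace M]

/-- The first `n` terms vanish and the tail is dominated by a geometric series times the diameter of
`M`. -/
theorem exists_latticeDist_le :
    ∃ D : ℝ, 0 ≤ D ∧ ∀ (n : ℕ) (x y : ℕ → M), (∀ i < n, x i = y i) →
      0 ≤ latticeDist x y ∧ latticeDist x y ≤ D * (1 / 2) ^ n := by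
  refine ⟨Metric.diam (Set.univ : Set M), Metric.diam_nonneg, fun n x y hxy => ?_⟩
  set D := Metric.diam (Set.univ : Set M)
  have hdist : ∀ a b : M, dist a b ≤ D := fun a b =>
    Metric.dist_le_diam_of_mem Set.finite_univ.isBounded (Set.mem_univ a) (Set.mem_univ b)
  have hnn : ∀ i : ℕ, 0 ≤ (1 / 2 : ℝ) ^ (i + 1) * dist (x i) (y i) := fun i => by positivity
  have hgeo : Summable fun i : ℕ => D / 2 * (1 / 2 : ℝ) ^ i :=
    (summable_geometric_of_lt_one (by norm_num) (by norm_num)).mul_left _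
  have hle : ∀ i : ℕ, (1 / 2 : ℝ) ^ (i + 1) * dist (x i) (y i) ≤ D / 2 * (1 / 2 : ℝ) ^ i :=
    fun i => by
      have := mul_le_mul_of_nonneg_left (hdist (x i) (y i))
        (show 0 ≤ (1 / 2 : ℝ) ^ (i + 1) by positivity)
      rw [pow_succ] at this ⊢
      linarith
  have hsum : Summable fun i : ℕ => (1 / 2 : ℝ) ^ (i + 1) * dist (x i) (y i) :=
    hgeo.of_nonneg_of_le hnn hle
  refine ⟨tsum_nonneg hnn, ?_⟩
  unfold latticeDist
  rw [← hsum.sum_add_tsum_nat_add n, Finset.sum_eq_zero fun i hi => by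
    simp [hxy i (Finset.mem_range.1 hi)], zero_add]
  calc ∑' i : ℕ, (1 / 2 : ℝ) ^ (i + n + 1) * dist (x (i + n)) (y (i + n))
      ≤ ∑' i : ℕ, D / 2 * (1 / 2 : ℝ) ^ n * (1 / 2 : ℝ) ^ i := by
        refine Summable.tsum_le_tsum (fun i => ?_) ((summable_nat_add_iff n).2 hsum)
          ((summable_geometric_of_lt_one (by norm_num) (by norm_num)).mul_left _)
        refine (hle (i + n)).trans_eq ?_
        rw [pow_add]
        ring
    _ = D * (1 / 2) ^ n := by
        rw [tsum_mul_left, tsum_geometric_of_lt_one (by norm_num) (by norm_num)]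
        ring

/-- A Hölder function varies exponentially little on long cylinders. -/
theorem IsHolderPotential.exists_variation_le {α : ℝ} (hα : 0 < α) {B : (ℕ → M) → ℝ}
    (hB : IsHolderPotential α B) :
    ∃ K r : ℝ, 0 ≤ K ∧ 0 ≤ r ∧ r < 1 ∧
      ∀ (n : ℕ) (x y : ℕ → M), (∀ i < n, x i = y i) → |B x - B y| ≤ K * r ^ n := by
  obtain ⟨C, hC⟩ := hB
  obtain ⟨D, hD, hdist⟩ := exists_latticeDist_le (M := M)
  refine ⟨|C| * D ^ α, (1 / 2 : ℝ) ^ α, by positivity, by positivity,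
    Real.rpow_lt_one (by norm_num) (by norm_num) hα, fun n x y hxy => ?_⟩
  obtain ⟨h0, h1⟩ := hdist n x y hxy
  calc |B x - B y| ≤ C * latticeDist x y ^ α := hC x y
    _ ≤ |C| * (D * (1 / 2) ^ n) ^ α :=
        mul_le_mul (le_abs_self C) (Real.rpow_le_rpow h0 h1 hα.le) (by positivity) (abs_nonneg C)
    _ = |C| * D ^ α * ((1 / 2 : ℝ) ^ α) ^ n := by
        rw [Real.mul_rpow hD (by positivity), ← Real.rpow_natCast, ← Real.rpow_natCast,
          ← Real.rpow_mul (by norm_num), ← Real.rpow_mul (by norm_num), mul_comm (n : ℝ) α]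
        ring

theorem isClopen_cylinderSet {M : Type*} [TopologicalSpace M] [DiscreteTopology M] {n : ℕ}
    (w : Fin n → M) : IsClopen (cylinderSet w) := by
  rw [cylinderSet_eq_preimage]
  exact (isClopen_discrete {w}).preimage (continuous_pi fun j => continuous_apply (j : ℕ))

theorem IsHolderPotential.continuous {α : ℝ} (hα : 0 < α) {B : (ℕ → M) → ℝ}
    (hB : IsHolderPotential α B) : Continuous B := by
  obtain ⟨K, r, hK, hr0, hr1, h⟩ := hB.exists_variation_le hα
  refine continuous_iff_continuousAt.2 fun x => Metric.tendsto_nhds.2 fun ε hε => ?_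
  have hlim : Tendsto (fun n : ℕ => K * r ^ n) atTop (𝓝 (K * 0)) :=
    (tendsto_pow_atTop_nhds_zero_of_lt_one hr0 hr1).const_mul K
  rw [mul_zero] at hlim
  obtain ⟨n, hn⟩ := (hlim.eventually_lt_const hε).exists
  have hx : x ∈ cylinderSet (initialWord n x) := fun j => rfl
  filter_upwards [(isClopen_cylinderSet (initialWord n x)).isOpen.mem_nhds hx] with y hy
  exact (h n y x fun i hi => hy ⟨i, hi⟩).trans_lt hn

end HolderPotentials

/-! ### Cylinder measures and entropy of Gibbs measures -/

section GibbsMeasures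

variable {M : Type*} [Fintype M] [MetricSpace M] [MeasurableSpace M] [BorelSpace M]

theorem integral_aprioriMeasure {p : M → ℝ} (hp : ∀ i, 0 ≤ p i) (f : M → ℝ) :
    ∫ a, f a ∂(aprioriMeasure p) = ∑ a, p a * f a := by
  unfold aprioriMeasure
  rw [integral_finsetSum_measure fun i _ =>
    (integrable_dirac (by simp)).smul_measure ENNReal.ofReal_ne_top]
  simp [integral_smul_measure, ENNReal.toReal_ofReal (hp _)]

theorem continuous_prepend {M : Type*} [TopologicalSpace M] (a : M) :
    Continuous (prepend a : (ℕ → M) → ℕ → M) :=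
  continuous_pi fun n => by
    cases n with
    | zero => exact continuous_const
    | succ n => exact continuous_apply n

theorem prepend_mem_cylinderSet_cons {M : Type*} {n : ℕ} (a b : M) (w : Fin n → M) (x : ℕ → M) :
    prepend b x ∈ cylinderSet (Fin.cons a w : Fin (n + 1) → M) ↔ b = a ∧ x ∈ cylinderSet w := by
  simp only [cylinderSet, Set.mem_ofPred_eq, Fin.forall_fin_succ, Fin.cons_zero, Fin.cons_succ]
  rfl

/-- Cylinders are clopen, so their indicators are admissible test functions in the dual equation; in
the Ruelle operator only the branch `a` survives. -/
theorem IsGibbsFor.measureReal_cylinderSet_cons {p : M → ℝ} (hp : ∀ i, 0 ≤ p i) {α : ℝ}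
    {μ : Measure (ℕ → M)} {B : (ℕ → M) → ℝ} (hμ : IsGibbsFor α (aprioriMeasure p) B μ)
    {n : ℕ} (a : M) (w : Fin n → M) :
    μ.real (cylinderSet (Fin.cons a w : Fin (n + 1) → M)) =
      ∫ x in cylinderSet w, p a * Real.exp (B (prepend a x)) ∂μ := by
  classical
  have hclop := isClopen_cylinderSet (Fin.cons a w : Fin (n + 1) → M)
  have h := hμ.fixed ⟨(cylinderSet (Fin.cons a w : Fin (n + 1) → M)).indicator fun _ => (1 : ℝ),
    continuous_const.indicator fun x hx => by simp [hclop.frontier_eq] at hx⟩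
  simp only [ContinuousMap.coe_mk] at h
  rw [integral_indicator_const _ hclop.isOpen.measurableSet, smul_eq_mul, mul_one] at h
  rw [h, ← integral_indicator (isClopen_cylinderSet w).isOpen.measurableSet]
  congr 1
  ext x
  rw [ruelleOp, integral_aprioriMeasure hp, Finset.sum_eq_single a]
  · by_cases hx : x ∈ cylinderSet w <;>
      simp [Set.indicator, prepend_mem_cylinderSet_cons, hx]
  · intro b _ hb
    simp [Set.indicator, prepend_mem_cylinderSet_cons, hb]
  · simp

theorem initialWord_succ {M : Type*} (n : ℕ) (y : ℕ → M) :
    initialWord (n + 1) y = Fin.cons (y 0) (initialWord n (shift y)) := by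
  ext j
  refine Fin.cases rfl (fun j => rfl) j

/-- Bounded distortion: the measure of a cylinder is comparable with the exponential of the
Birkhoff sum of the potential. -/
theorem IsGibbsFor.exists_abs_log_sub_birkhoffSum_le {p : M → ℝ} (hp : ∀ i, 0 < p i) {α : ℝ}
    (hα : 0 < α) {μ : Measure (ℕ → M)} {B : (ℕ → M) → ℝ}
    (hμ : IsGibbsFor α (aprioriMeasure p) B μ) :
    ∃ D : ℝ, ∀ (n : ℕ) (y : ℕ → M), 0 < μ.real (cylinderSet (initialWord n y)) ∧
      |Real.log (μ.real (cylinderSet (initialWord n y)) / ∏ j, p (initialWord n y j)) -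
        birkhoffSum shift B n y| ≤ D := by
  have := hμ.isProbabilityMeasure
  obtain ⟨K, r, hK, hr0, hr1, hvar⟩ := hμ.isHolder.exists_variation_le hα
  have hgeo : Summable fun k : ℕ => K * r ^ k := (summable_geometric_of_lt_one hr0 hr1).mul_left K
  suffices hind : ∀ (n : ℕ) (y : ℕ → M), 0 < μ.real (cylinderSet (initialWord n y)) ∧
      |Real.log (μ.real (cylinderSet (initialWord n y)) / ∏ j, p (initialWord n y j)) -
        -- Passing from length `n` to `n + 1` costs `K * r ^ (n + 1)`; the term `k = 0` is slack.
        birkhoffSum shift B n y| ≤ ∑ k ∈ Finset.range (n + 1), K * r ^ k by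
    exact ⟨∑' k : ℕ, K * r ^ k, fun n y => ⟨(hind n y).1, (hind n y).2.trans
      (hgeo.sum_le_tsum _ fun k _ => by positivity)⟩⟩
  intro n
  induction n with
  | zero =>
    intro y
    have huniv : cylinderSet (initialWord 0 y) = Set.univ := by
      ext x
      simp [cylinderSet]
    simp [huniv, hK]
  | succ n ih =>
    intro y
    obtain ⟨hpos, habs⟩ := ih (shift y)
    rw [initialWord_succ, birkhoffSum_succ', Finset.sum_range_succ,
      hμ.measureReal_cylinderSet_cons fun i => (hp i).le]
    simp only [Fin.prod_univ_succ, Fin.cons_zero, Fin.cons_succ]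
    set w := initialWord n (shift y)
    set v := K * r ^ (n + 1)
    set a := y 0
    have hms : MeasurableSet (cylinderSet w) := (isClopen_cylinderSet w).isOpen.measurableSet
    have hcont : Continuous fun x => p a * Real.exp (B (prepend a x)) :=
      continuous_const.mul (Real.continuous_exp.comp
        ((hμ.isHolder.continuous hα).comp (continuous_prepend a)))
    -- `y` starts with `a` followed by `w`, so it shares `n + 1` coordinates with `prepend a x`.
    have hvarw : ∀ x ∈ cylinderSet w, |B (prepend a x) - B y| ≤ v := fun x hx =>
      hvar (n + 1) _ _ fun i hi => by
        cases i with
        | zero => rfl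
        | succ i => exact hx ⟨i, by omega⟩
    have hint : IntegrableOn (fun x => p a * Real.exp (B (prepend a x))) (cylinderSet w) μ := by
      refine Measure.integrableOn_of_bounded (M := p a * Real.exp (B y + v)) (measure_ne_top _ _)
        hcont.aestronglyMeasurable ?_
      filter_upwards [ae_restrict_mem hms] with x hx
      rw [Real.norm_of_nonneg (mul_nonneg (hp a).le (Real.exp_pos _).le)]
      have := (abs_le.1 (hvarw x hx)).2
      exact mul_le_mul_of_nonneg_left (Real.exp_le_exp.2 (by linarith)) (hp a).le
    have hconst : ∀ c : ℝ, IntegrableOn (fun _ => c) (cylinderSet w) μ := fun c =>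
      (integrable_const c).integrableOn
    have hup : ∫ x in cylinderSet w, p a * Real.exp (B (prepend a x)) ∂μ ≤
        p a * Real.exp (B y + v) * μ.real (cylinderSet w) := by
      refine (setIntegral_mono_on hint (hconst (p a * Real.exp (B y + v))) hms fun x hx => ?_).trans
        (by simp [mul_comm])
      have := (abs_le.1 (hvarw x hx)).2
      exact mul_le_mul_of_nonneg_left (Real.exp_le_exp.2 (by linarith)) (hp a).le
    have hlow : p a * Real.exp (B y - v) * μ.real (cylinderSet w) ≤
        ∫ x in cylinderSet w, p a * Real.exp (B (prepend a x)) ∂μ := by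
      refine le_trans (by simp [mul_comm])
        (setIntegral_mono_on (hconst (p a * Real.exp (B y - v))) hint hms fun x hx => ?_)
      have := (abs_le.1 (hvarw x hx)).1
      exact mul_le_mul_of_nonneg_left (Real.exp_le_exp.2 (by linarith)) (hp a).le
    set I := ∫ x in cylinderSet w, p a * Real.exp (B (prepend a x)) ∂μ
    have hpa := hp a
    have hI : 0 < I := lt_of_lt_of_le (by positivity) hlow
    refine ⟨hI, ?_⟩
    have hprod : 0 < ∏ j, p (w j) := Finset.prod_pos fun j _ => hp _
    have hlogup := Real.log_le_log hI hup
    have hloglow := Real.log_le_log (by positivity) hlow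
    rw [Real.log_mul (by positivity) hpos.ne', Real.log_mul hpa.ne' (Real.exp_pos _).ne',
      Real.log_exp] at hlogup hloglow
    rw [Real.log_div hpos.ne' hprod.ne'] at habs
    rw [Real.log_div hI.ne' (by positivity), Real.log_mul hpa.ne' hprod.ne']
    rw [abs_le] at habs ⊢
    constructor <;> linarith [habs.1, habs.2]

theorem IsGibbsFor.integrable {ν : Measure M} {α : ℝ} (hα : 0 < α) {μ : Measure (ℕ → M)}
    {B : (ℕ → M) → ℝ} (hμ : IsGibbsFor α ν B μ) : Integrable B μ := by
  have := hμ.isProbabilityMeasure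
  obtain ⟨C, hC⟩ := isCompact_univ.exists_bound_of_continuousOn
    (hμ.isHolder.continuous hα).continuousOn
  exact Integrable.of_bound (hμ.isHolder.continuous hα).aestronglyMeasurable C
    (ae_of_all _ fun x => hC x (Set.mem_univ x))

theorem IsGibbsFor.tendsto_sum_log {p : M → ℝ} (hp : ∀ i, 0 < p i) {α : ℝ} (hα : 0 < α)
    {μ : Measure (ℕ → M)} {B : (ℕ → M) → ℝ} (hμ : IsGibbsFor α (aprioriMeasure p) B μ) :
    Tendsto (fun n : ℕ => 1 / (n : ℝ) * ∑ w : Fin n → M, μ.real (cylinderSet w) *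
      Real.log (μ.real (cylinderSet w) / ∏ j, p (w j))) atTop (𝓝 (∫ x, B x ∂μ)) := by
  have := hμ.isProbabilityMeasure
  obtain ⟨D, hD⟩ := hμ.exists_abs_log_sub_birkhoffSum_le hp hα
  have hBint := hμ.integrable hα
  have hbound : ∀ n : ℕ, |(∑ w : Fin n → M, μ.real (cylinderSet w) *
      Real.log (μ.real (cylinderSet w) / ∏ j, p (w j))) - n * ∫ x, B x ∂μ| ≤ D := fun n => by
    have h1 := integral_comp_of_fintype (μ := μ) (measurable_initialWord (M := M) n)
      (fun w => Real.log (μ.real (cylinderSet w) / ∏ j, p (w j)))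
    simp only [← cylinderSet_eq_preimage] at h1
    have hi := integrable_comp_of_fintype (μ := μ) (measurable_initialWord (M := M) n)
      (fun w => Real.log (μ.real (cylinderSet w) / ∏ j, p (w j)))
    have hb : Integrable (fun x => ∑ j ∈ Finset.range n, B (shift^[j] x)) μ :=
      integrable_finsetSum _ fun j _ =>
        (hμ.invariant.iterate j).integrable_comp_of_integrable hBint
    rw [← h1, ← integral_sum_comp_iterate hμ.invariant hBint, ← integral_sub hi hb]
    have := norm_integral_le_of_norm_le_const (μ := μ)
      (f := fun x => Real.log (μ.real (cylinderSet (initialWord n x)) /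
        ∏ j, p (initialWord n x j)) - birkhoffSum shift B n x) (ae_of_all _ fun x => (hD n x).2)
    simpa [birkhoffSum] using this
  rw [← tendsto_sub_nhds_zero_iff]
  refine squeeze_zero_norm' ?_ (tendsto_const_div_atTop_nhds_zero_nat D)
  filter_upwards [eventually_gt_atTop 0] with n hn
  have hn' : (0 : ℝ) < n := by exact_mod_cast hn
  have hfac : ∀ S b : ℝ, 1 / (n : ℝ) * S - b = (S - n * b) / n := fun S b => by field_simp
  rw [Real.norm_eq_abs, hfac, abs_div, abs_of_pos hn']
  exact div_le_div_of_nonneg_right (hbound n) hn'.le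

/-- By invariance every coordinate has the law of the zeroth one. -/
theorem sum_measureReal_cylinderSet_mul_sum {μ : Measure (ℕ → M)} [IsProbabilityMeasure μ]
    (hμ : MeasurePreserving shift μ μ) (f : M → ℝ) (n : ℕ) :
    ∑ w : Fin n → M, μ.real (cylinderSet w) * ∑ j, f (w j) =
      n * ∑ i, f i * μ.real (cylinderSet ![i]) := by
  have h1 := integral_comp_of_fintype (μ := μ) (measurable_initialWord (M := M) n)
    (fun w => ∑ j, f (w j))
  have h0 : Measurable fun x : ℕ → M => x 0 := measurable_pi_apply 0
  have h2 := integral_comp_of_fintype (μ := μ) h0 f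
  have h3 := integral_sum_comp_iterate hμ (integrable_comp_of_fintype (μ := μ) h0 f) n
  simp only [← cylinderSet_eq_preimage] at h1
  rw [← h1]
  simp only [Finset.sum_range, shift_iterate_apply, add_zero] at h3
  simp only [initialWord]
  rw [h3, h2]
  congr 1
  refine Finset.sum_congr rfl fun i _ => ?_
  rw [mul_comm]
  congr 2
  ext x
  simp [cylinderSet]

theorem partitionEntropy_initialWord {p : M → ℝ} (hp : ∀ i, 0 < p i) {μ : Measure (ℕ → M)}
    [IsProbabilityMeasure μ] (hμ : MeasurePreserving shift μ μ) (n : ℕ) :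
    partitionEntropy μ (initialWord (M := M) n) =
      -(∑ w : Fin n → M, μ.real (cylinderSet w) *
        Real.log (μ.real (cylinderSet w) / ∏ j, p (w j))) -
      n * ∑ i, Real.log (p i) * μ.real (cylinderSet ![i]) := by
  rw [← sum_measureReal_cylinderSet_mul_sum hμ, ← Finset.sum_neg_distrib,
    ← Finset.sum_sub_distrib, partitionEntropy]
  refine Finset.sum_congr rfl fun w _ => ?_
  rw [← cylinderSet_eq_preimage, ← Real.log_prod fun j _ => (hp _).ne']
  rcases eq_or_ne (μ.real (cylinderSet w)) 0 with h | h
  · simp [h]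
  · rw [Real.log_div h (Finset.prod_pos fun j _ => hp _).ne', Real.negMulLog]
    ring

end GibbsMeasures

theorem proposition7 {M : Type*} [Fintype M] [MetricSpace M] [MeasurableSpace M] [BorelSpace M]
    (p : M → ℝ) (hp : ∀ i, 0 < p i) (hsum : ∑ i, p i = 1)
    (α : ℝ) (hα : 0 < α)
    (μ : Measure (ℕ → M)) (B : (ℕ → M) → ℝ) (hμ : IsGibbsFor α (aprioriMeasure p) B μ) :
    kolmogorovEntropy μ shift =
        ((gibbsEntropy B μ - ∑ i, Real.log (p i) * μ.real (cylinderSet ![i]) : ℝ) : EReal) ∧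
      Tendsto
        (fun n : ℕ => -(1 / (n : ℝ) * ∑ w : Fin n → M, μ.real (cylinderSet w) *
          Real.log (μ.real (cylinderSet w) / ∏ j, p (w j))))
        atTop (𝓝 (gibbsEntropy B μ)) := by
  have := hμ.isProbabilityMeasure
  have hlim := (hμ.tendsto_sum_log hp hα).neg
  refine ⟨kolmogorovEntropy_shift_of_tendsto hμ.invariant ?_, hlim⟩
  refine (hlim.sub_const (∑ i, Real.log (p i) * μ.real (cylinderSet ![i]))).congr' ?_
  filter_upwards [eventually_gt_atTop 0] with n hn
  have hn' : (n : ℝ) ≠ 0 := by exact_mod_cast hn.ne'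
  rw [partitionEntropy_initialWord hp hμ.invariant]
  field_simp
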